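/- Let $k$ be a perfect field, let $N\ge 3$, let $S=k[x_0,\ldots,x_{N-1}]$ be the standard graded polynomial ring in $N$ variables, and let $\mathbf m=(x_0,\ldots,x_{N-1})$. Let $I$ be a radical homogeneous ideal of $S$ of height $N-1$ that is minimally generated by $\binom N2$ quadrics, i.e. $I$ is generated by a set of $\binom N2$ homogeneous polynomials of degree $2$ no proper subset of which generates $I$. For an integer $m\ge 1$ let $$I^{(m)}=\bigcap_{p\in\operatorname{Ass}_S(S/I)}\left(I^mS_p\cap S\right)$$ be the $m$-th symbolic power of $I$, where $I^mS_p\cap S$ denotes the preimage in $S$ of the extension of $I^m$ to the localization $S_p$. Then, for every integer $m\ge 1$, $$\operatorname{ann}_S\left(I^{(m)}/I^m\right)=\mathbf m^{\left\lfloor \frac{m(N-2)}{N-1}\right\rfloor}.$$ -/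

import Mathlib

open MvPolynomial

attribute [local instance] MvPolynomial.gradedAlgebra

/-- The `m`-th symbolic power `I^(m) = ⋂_{p ∈ Ass(S/I)} (I^m S_p ∩ S)` of an ideal `I`,
where `I^m S_p ∩ S` is the preimage in `S` of the extension of `I^m` to the localization `S_p`. -/
def symbolicPower {S : Type*} [CommRing S] (I : Ideal S) (m : ℕ) : Ideal S :=
  ⨅ p : {p : Ideal S // IsAssociatedPrime p (S ⧸ I)},
    haveI : p.1.IsPrime := p.2.isPrime
    ((I ^ m).map (algebraMap S (Localization.AtPrime p.1))).comap
      (algebraMap S (Localization.AtPrime p.1))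

theorem pow_le_symbolicPower {S : Type*} [CommRing S] (I : Ideal S) (m : ℕ) :
    I ^ m ≤ symbolicPower I m :=
  le_iInf fun _ => Ideal.le_comap_map

/-- The `S`-module `I^(m) / I^m`. The submodule `(I ^ m).submoduleOf (symbolicPower I m)` is
`I^m` regarded as a submodule of `I^(m)`, which contains it. -/
abbrev SymbolicPowerQuotient {S : Type*} [CommRing S] (I : Ideal S) (m : ℕ) : Type _ :=
  ↥(symbolicPower I m) ⧸ (I ^ m).submoduleOf (symbolicPower I m)

/-- `G` generates the ideal `I`, and no proper subset of `G` does. -/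
def IsMinimalGeneratingSet {S : Type*} [CommRing S] (I : Ideal S) (G : Finset S) : Prop :=
  Ideal.span (G : Set S) = I ∧ ∀ H : Finset S, H ⊂ G → Ideal.span (H : Set S) ≠ I

/-- `I` is minimally generated by `n` quadrics, i.e. by `n` forms of degree two. -/
def IsMinimallyGeneratedByQuadrics {k : Type*} [Field k] {N : ℕ}
    (I : Ideal (MvPolynomial (Fin N) k)) (n : ℕ) : Prop :=
  ∃ G : Finset (MvPolynomial (Fin N) k),
    G.card = n ∧ (∀ q ∈ G, q.IsHomogeneous 2) ∧ IsMinimalGeneratingSet I G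

/-!
Over an algebraic closure `K` of `k` the ideal `I` becomes the ideal `J = (x_i x_j : i ≠ j)` of the
`N` coordinate points of projective space, after a linear change of coordinates. Indeed, `k` being
perfect, `I` stays radical over `K` (`isRadical_map_of_perfectField`), and an ideal generated by
quadrics that is radical does not have the irrelevant maximal ideal as an associated prime
(`mem_of_forall_mul_X_mem`), so some linear form `l` is a nonzerodivisor modulo `I`. Counting
dimensions, the quadrics modulo `I` have dimension at most `N`, hence are the multiples of `l` by
linear forms. Thus `a ↦ (b ↦ l⁻¹ a b)` is a commuting family of operators on the linear forms; they
are diagonalizable because the quotient is reduced, and a joint eigenbasis consists of forms with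
pairwise products in `I` (`exists_basis_mul_eq_zero`, `exists_algEquiv_map_coordinatePointsIdeal`).

For `J` everything is monomial. A polynomial lies in `J ^ m` as soon as all its monomials have degree
at least `2 * m` and it vanishes to order `m` along each coordinate axis
(`mem_coordinatePointsIdeal_pow`), while vanishing to order `m` along all axes forces degree at least
`N * m / (N - 1)`, that is, at least `2 * m - e` with `e = ⌊m * (N - 2) / (N - 1)⌋`. As elements of
`I^(m)` vanish to order `m` along the axes, forms of degree `e` multiply them into `I ^ m`.
Conversely `I^(m)` contains a form of degree exactly `2 * m - e`, and `I ^ m` starts in degree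
`2 * m`; since orders add up in products, an element of the annihilator has order at least `e`.

The passage between `k` and `K` uses `k`-linear functionals `K → k` applied to coefficients: these
maps `K[x] → k[x]` are `k[x]`-linear and send `I ^ m K[x]` into `I ^ m`. They show that extended
ideals contract back, that the primes of the axes contract to associated primes of `I`
(`isAssociatedPrime_comap_axis`), and that the monomial of degree `2 * m - e` over `K` yields a form
over `k` (`exists_form_forall_mul_mem`).
-/

/-! ### Weighted orders -/

/-- The ideal of polynomials all of whose monomials have `w`-weight at least `n`. It is phrased
through the weighted order of power series, which is additive on products over a domain. -/
noncomputable def orderIdeal {σ K : Type*} [Field K] (w : σ → ℕ) (n : ℕ) :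
    Ideal (MvPolynomial σ K) where
  carrier := {f | (n : ℕ∞) ≤ (f : MvPowerSeries σ K).weightedOrder w}
  zero_mem' := by simp
  add_mem' {f g} hf hg := by
    simp only [Set.mem_ofPred_eq, coe_add] at *
    exact (le_min hf hg).trans (MvPowerSeries.min_weightedOrder_le_add w)
  smul_mem' c f hf := by
    simp only [Set.mem_ofPred_eq, smul_eq_mul, coe_mul] at *
    exact (hf.trans le_add_self).trans (MvPowerSeries.le_weightedOrder_mul w)

section Order

variable {σ K : Type*} [Field K] {w : σ → ℕ} {m n : ℕ} {f g : MvPolynomial σ K}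

theorem mem_orderIdeal : f ∈ orderIdeal w n ↔
    (n : ℕ∞) ≤ (f : MvPowerSeries σ K).weightedOrder w := Iff.rfl

theorem mem_orderIdeal_iff_coeff :
    f ∈ orderIdeal w n ↔ ∀ d, Finsupp.weight w d < n → coeff d f = 0 := by
  rw [mem_orderIdeal]
  constructor
  · intro h d hd
    rw [← coeff_coe]
    exact MvPowerSeries.coeff_eq_zero_of_lt_weightedOrder w
      (lt_of_lt_of_le (by exact_mod_cast hd) h)
  · intro h
    refine MvPowerSeries.nat_le_weightedOrder w fun d hd => ?_
    rw [coeff_coe]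
    exact h d hd

theorem mem_orderIdeal_iff_support :
    f ∈ orderIdeal w n ↔ ∀ d ∈ f.support, n ≤ Finsupp.weight w d := by
  rw [mem_orderIdeal_iff_coeff]
  refine forall_congr' fun d => ?_
  rw [mem_support_iff]
  constructor
  · intro h h1
    by_contra h2
    exact h1 (h (by omega))
  · intro h h1
    by_contra h2
    have := h h2
    omega

theorem mul_mem_orderIdeal (hf : f ∈ orderIdeal w m) (hg : g ∈ orderIdeal w n) :
    f * g ∈ orderIdeal w (m + n) := by
  rw [mem_orderIdeal] at *
  rw [coe_mul, Nat.cast_add]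
  exact (add_le_add hf hg).trans (MvPowerSeries.le_weightedOrder_mul w)

theorem orderIdeal_mul_le : (orderIdeal w m * orderIdeal w n : Ideal (MvPolynomial σ K)) ≤
    orderIdeal w (m + n) :=
  Ideal.mul_le.2 fun _ hf _ hg => mul_mem_orderIdeal hf hg

theorem orderIdeal_zero : (orderIdeal w 0 : Ideal (MvPolynomial σ K)) = ⊤ :=
  (Ideal.eq_top_iff_one _).2 (by simp [mem_orderIdeal])

theorem orderIdeal_anti (h : m ≤ n) :
    (orderIdeal w n : Ideal (MvPolynomial σ K)) ≤ orderIdeal w m := fun f hf => by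
  rw [mem_orderIdeal] at *
  exact le_trans (by exact_mod_cast h) hf

theorem pow_le_orderIdeal {J : Ideal (MvPolynomial σ K)} (h : J ≤ orderIdeal w n) (m : ℕ) :
    J ^ m ≤ orderIdeal w (m * n) := by
  induction m with
  | zero => simp [orderIdeal_zero]
  | succ m ih =>
    rw [pow_succ, add_mul, one_mul]
    exact (Ideal.mul_mono ih h).trans orderIdeal_mul_le

/-- Additivity of the order, as a cancellation rule. -/
theorem mem_orderIdeal_of_mul_mem (h : f * g ∈ orderIdeal w (m + n))
    (hf : f ∉ orderIdeal w (m + 1)) : g ∈ orderIdeal w n := by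
  rw [mem_orderIdeal] at *
  rw [coe_mul, MvPowerSeries.weightedOrder_mul] at h
  have h1 : (f : MvPowerSeries σ K).weightedOrder w ≤ m := by
    rw [not_le] at hf
    exact Order.le_of_lt_add_one (by exact_mod_cast hf)
  have h2 := h.trans (add_le_add_left h1 _)
  rw [Nat.cast_add] at h2
  exact (ENat.add_le_add_iff_left (ENat.natCast_ne_top m)).1 h2

theorem orderIdeal_one_eq_idealOfVars_pow (n : ℕ) :
    (orderIdeal 1 n : Ideal (MvPolynomial σ K)) = idealOfVars σ K ^ n := by
  ext f
  rw [mem_orderIdeal_iff_support, mem_pow_idealOfVars_iff]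
  simp [Finsupp.degree_eq_weight_one, Pi.one_def]

theorem X_mem_orderIdeal (i : σ) : (X i : MvPolynomial σ K) ∈ orderIdeal w (w i) := by
  rw [mem_orderIdeal_iff_support]
  intro d hd
  rw [support_X, Finset.mem_singleton] at hd
  rw [hd, Finsupp.weight_single]
  simp

theorem orderIdeal_one_isPrime :
    (orderIdeal w 1 : Ideal (MvPolynomial σ K)).IsPrime := by
  refine ⟨fun h => ?_, fun {f g} h => ?_⟩
  · have h1 := (Ideal.eq_top_iff_one _).1 h
    rw [mem_orderIdeal_iff_coeff] at h1
    simpa using h1 0 (by simp)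
  · by_contra! h'
    exact h'.2 (mem_orderIdeal_of_mul_mem (m := 0) (by simpa using h) h'.1)

theorem mem_orderIdeal_of_isHomogeneous (hf : f.IsHomogeneous n) :
    f ∈ orderIdeal 1 n := by
  rw [mem_orderIdeal_iff_support]
  intro d hd
  exact (hf (mem_support_iff.1 hd)).ge

end Order

theorem weight_one {σ : Type*} (d : σ →₀ ℕ) : Finsupp.weight (1 : σ → ℕ) d = d.degree := by
  simp [Finsupp.degree_eq_weight_one, Pi.one_def]

/-! ### Powers of the ideal of the coordinate points -/

/-- The weight that counts all variables except `X i`. The associated order is the order of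
vanishing along the `i`-th coordinate axis. -/
def axisWeight {σ : Type*} [DecidableEq σ] (i : σ) : σ → ℕ := fun j => if j = i then 0 else 1

/-- The ideal `(X i * X j : i ≠ j)` of the union of the coordinate axes, that is, of the coordinate
points of projective space. -/
noncomputable def coordinatePointsIdeal (σ K : Type*) [Field K] : Ideal (MvPolynomial σ K) :=
  Ideal.span {f | ∃ i j, i ≠ j ∧ f = X i * X j}

section Coordinate

variable {σ K : Type*} [Fintype σ] [DecidableEq σ] [Field K]

theorem weight_axisWeight_add (i : σ) (d : σ →₀ ℕ) :
    Finsupp.weight (axisWeight i) d + d i = d.degree := by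
  rw [Finsupp.weight_apply, Finsupp.sum_fintype _ _ (by simp), Finsupp.degree_eq_sum,
    ← Finset.sum_erase_add _ _ (Finset.mem_univ i), ← Finset.sum_erase_add _ d (Finset.mem_univ i)]
  have : ∑ x ∈ Finset.univ.erase i, d x • axisWeight i x = ∑ x ∈ Finset.univ.erase i, d x :=
    Finset.sum_congr rfl fun x hx => by simp [axisWeight, Finset.ne_of_mem_erase hx]
  rw [this]
  simp [axisWeight]

theorem coordinatePointsIdeal_le_axis {σ K : Type*} [DecidableEq σ] [Field K] (i : σ) :
    coordinatePointsIdeal σ K ≤ orderIdeal (axisWeight i) 1 := by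
  refine Ideal.span_le.2 ?_
  rintro _ ⟨a, b, hab, rfl⟩
  have h := mul_mem_orderIdeal (X_mem_orderIdeal (K := K) (w := axisWeight i) a)
    (X_mem_orderIdeal (K := K) (w := axisWeight i) b)
  refine orderIdeal_anti ?_ h
  unfold axisWeight
  split_ifs with h1 h2 <;> first | omega | exact absurd (h1.trans h2.symm) hab

/-- A monomial of degree at least `2 * m` whose degree outside each variable is at least `m` is a
multiple of a product of `m` edges `X i * X j`. -/
theorem monomial_mem_coordinatePointsIdeal_pow (m : ℕ) (d : σ →₀ ℕ) (hd : 2 * m ≤ d.degree)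
    (h : ∀ i, m + d i ≤ d.degree) (c : K) :
    monomial d c ∈ coordinatePointsIdeal σ K ^ m := by
  induction m generalizing d with
  | zero => simp
  | succ m ih =>
    have hdpos : d.degree ≠ 0 := by omega
    have hne : Nonempty σ := by
      by_contra hn
      rw [not_nonempty_iff] at hn
      exact hdpos (by simp [Finsupp.degree_eq_sum])
    -- `i` and `j` carry the two largest exponents
    obtain ⟨i, -, hi⟩ := Finset.exists_max_image Finset.univ (fun i => d i)
      Finset.univ_nonempty
    have hsum : d.degree = ∑ x ∈ Finset.univ.erase i, d x + d i := by
      rw [Finsupp.degree_eq_sum, Finset.sum_erase_add _ _ (Finset.mem_univ i)]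
    have hpos : ∑ x ∈ Finset.univ.erase i, d x ≠ 0 := by
      have := h i
      omega
    obtain ⟨j0, hj0, hj0'⟩ := Finset.exists_ne_zero_of_sum_ne_zero hpos
    obtain ⟨j, hj, hjmax⟩ := Finset.exists_max_image (Finset.univ.erase i) (fun i => d i)
      ⟨j0, hj0⟩
    have hij : j ≠ i := Finset.ne_of_mem_erase hj
    have hdj : 1 ≤ d j := by have := hjmax j0 hj0; omega
    have hdi : 1 ≤ d i := hdj.trans (hi j (Finset.mem_univ j))
    have hle : Finsupp.single i 1 + Finsupp.single j 1 ≤ d := by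
      intro x
      by_cases h1 : x = i
      · subst h1; simp [hij.symm, hdi]
      · by_cases h2 : x = j
        · subst h2; simp [hij, hdj]
        · simp [Ne.symm h1, Ne.symm h2]
    obtain ⟨d', rfl⟩ := exists_add_of_le hle
    have hdeg : (Finsupp.single i 1 + Finsupp.single j 1 + d').degree = 2 + d'.degree := by
      simp [map_add]
    rw [hdeg] at hd h
    have e1 : (monomial (Finsupp.single i 1 + Finsupp.single j 1 + d') c : MvPolynomial σ K) =
        monomial d' c * (X i * X j) := by
      rw [X, X, monomial_mul, monomial_mul, one_mul, mul_one, add_comm]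
    rw [e1, pow_succ]
    refine Ideal.mul_mem_mul (ih d' (by omega) fun l => ?_)
      (Ideal.subset_span ⟨i, j, hij.symm, rfl⟩)
    have hl := h l
    by_cases hli : l = i
    · subst hli; simp at hl; omega
    by_cases hlj : l = j
    · subst hlj; simp at hl; omega
    -- otherwise `d' l` is bounded by the exponents at `i` and `j`
    have hli' := hi l (Finset.mem_univ l)
    have hlj' := hjmax l (Finset.mem_erase.2 ⟨hli, Finset.mem_univ l⟩)
    have h3 : d' i + (d' j + d' l) ≤ d'.degree := by
      rw [Finsupp.degree_eq_sum]
      have : ∑ x ∈ ({i, j, l} : Finset σ), d' x = d' i + (d' j + d' l) := by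
        rw [Finset.sum_insert (by simp [hij.symm, Ne.symm hli]),
          Finset.sum_insert (by simp [Ne.symm hlj]), Finset.sum_singleton]
      rw [← this]
      exact Finset.sum_le_sum_of_subset (Finset.subset_univ _)
    simp [hij, hij.symm, Ne.symm hli, Ne.symm hlj] at hli' hlj'
    omega

/-- In degrees at least `2 * m` the `m`-th power of the ideal of the coordinate points consists of
the polynomials that vanish to order `m` along every axis. -/
theorem mem_coordinatePointsIdeal_pow {m : ℕ} {f : MvPolynomial σ K}
    (h2 : f ∈ orderIdeal 1 (2 * m)) (h : ∀ i, f ∈ orderIdeal (axisWeight i) m) :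
    f ∈ coordinatePointsIdeal σ K ^ m := by
  rw [f.as_sum]
  refine Ideal.sum_mem _ fun d hd => monomial_mem_coordinatePointsIdeal_pow m d ?_ (fun i => ?_) _
  · rw [← weight_one]
    exact mem_orderIdeal_iff_support.1 h2 d hd
  · rw [← weight_axisWeight_add i d]
    have := mem_orderIdeal_iff_support.1 (h i) d hd
    omega

/-- Vanishing to order `m` along each of the `N` axes forces `(N - 1) * |d| ≥ N * m` for every
monomial `d`. -/
theorem mem_orderIdeal_one_of_axis {m n : ℕ} {f : MvPolynomial σ K}
    (h : ∀ i, f ∈ orderIdeal (axisWeight i) m)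
    (hn : ∀ a, Fintype.card σ * m + a ≤ Fintype.card σ * a → n ≤ a) :
    f ∈ orderIdeal 1 n := by
  rw [mem_orderIdeal_iff_support]
  intro d hd
  rw [weight_one]
  refine hn _ ?_
  have h1 : ∀ i ∈ Finset.univ, m + d i ≤ d.degree := fun i _ => by
    rw [← weight_axisWeight_add i d]
    have := mem_orderIdeal_iff_support.1 (h i) d hd
    omega
  have h2 := Finset.sum_le_sum h1
  rw [Finset.sum_add_distrib, ← Finsupp.degree_eq_sum] at h2
  simpa using h2

end Coordinate

/-- A number `s ≤ n * c` is a sum of `n` natural numbers not exceeding `c`. -/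
theorem exists_sum_eq_of_le_mul (n c s : ℕ) (h : s ≤ n * c) :
    ∃ a : Fin n → ℕ, (∀ i, a i ≤ c) ∧ ∑ i, a i = s := by
  induction n generalizing s with
  | zero => exact ⟨fun _ => 0, by simp, by simp at h; simp [h]⟩
  | succ n ih =>
    rw [add_mul, one_mul] at h
    obtain ⟨a, ha, hs⟩ := ih (s - min s c) (by omega)
    refine ⟨Fin.cons (min s c) a, fun i => ?_, ?_⟩
    · refine Fin.cases ?_ (fun j => ?_) i
      · simp
      · simpa using ha j
    · rw [Fin.sum_univ_succ]
      simp [hs]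

/-! ### Descent along a field extension -/

section Descent

variable {σ k K : Type*} [Field k] [Field K] [Algebra k K]

/-- Apply a `k`-linear functional `K → k` to all coefficients of a polynomial over `K`. -/
noncomputable def coeffFunctional (l : K →ₗ[k] k) : MvPolynomial σ K →ₗ[k] MvPolynomial σ k :=
  (basisMonomials σ k).repr.symm.toLinearMap ∘ₗ Finsupp.mapRange.linearMap l ∘ₗ
    (basisMonomials σ K).repr.toLinearMap.restrictScalars k

@[simp]
theorem coeff_coeffFunctional (l : K →ₗ[k] k) (f : MvPolynomial σ K) (d : σ →₀ ℕ) :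
    coeff d (coeffFunctional l f) = l (coeff d f) := by
  have h : ∀ g : MvPolynomial σ k, coeff d g = (basisMonomials σ k).repr g d := fun _ => rfl
  rw [h, coeffFunctional, LinearMap.comp_apply, LinearEquiv.coe_coe, LinearEquiv.apply_symm_apply]
  rfl

/-- `coeffFunctional l` is linear over the polynomial ring `k[x]`. -/
theorem coeffFunctional_map_mul (l : K →ₗ[k] k) (f : MvPolynomial σ k) (g : MvPolynomial σ K) :
    coeffFunctional l (map (algebraMap k K) f * g) = f * coeffFunctional l g := by
  classical
  ext d
  simp only [coeff_coeffFunctional, coeff_mul, map_sum, coeff_map, ← Algebra.smul_def, map_smul,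
    smul_eq_mul]

theorem coeffFunctional_mem {I : Ideal (MvPolynomial σ k)} (l : K →ₗ[k] k)
    {f : MvPolynomial σ K} (hf : f ∈ I.map (map (algebraMap k K))) : coeffFunctional l f ∈ I := by
  rw [Ideal.map] at hf
  induction hf using Submodule.closure_induction with
  | zero => simp
  | add x y _ _ hx hy => rw [map_add]; exact add_mem hx hy
  | smul_mem a x hx =>
    obtain ⟨y, hy, rfl⟩ := hx
    rw [smul_eq_mul, mul_comm, coeffFunctional_map_mul]
    exact Ideal.mul_mem_right _ _ hy

/-- Expansion of a polynomial over `K` along a basis of `K` over `k`. -/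
theorem exists_eq_sum_coeffFunctional {ι : Type*} (b : Module.Basis ι k K)
    (f : MvPolynomial σ K) :
    ∃ T : Finset ι, f = ∑ t ∈ T, C (b t) * map (algebraMap k K) (coeffFunctional (b.coord t) f) := by
  classical
  refine ⟨f.support.biUnion fun d => (b.repr (coeff d f)).support, ?_⟩
  ext d
  simp only [coeff_sum, coeff_C_mul, coeff_map, coeff_coeffFunctional, Module.Basis.coord_apply]
  by_cases hd : d ∈ f.support
  · conv_lhs => rw [← b.linearCombination_repr (coeff d f), Finsupp.linearCombination_apply]
    rw [Finsupp.sum_of_support_subset _ (Finset.subset_biUnion_of_mem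
      (fun d => (b.repr (coeff d f)).support) hd) _ (by simp)]
    exact Finset.sum_congr rfl fun t _ => by rw [Algebra.smul_def, mul_comm]
  · rw [notMem_support_iff] at hd
    simp [hd]

theorem exists_coeffFunctional_notMem {P : Ideal (MvPolynomial σ K)} {f : MvPolynomial σ K}
    (hf : f ∉ P) :
    ∃ l : K →ₗ[k] k, map (algebraMap k K) (coeffFunctional l f) ∉ P := by
  by_contra! h
  obtain ⟨T, hT⟩ := exists_eq_sum_coeffFunctional (Module.Free.chooseBasis k K) f
  refine hf ?_
  rw [hT]
  exact Ideal.sum_mem _ fun t _ => Ideal.mul_mem_left _ _ (h _)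

theorem mem_of_map_mem {I : Ideal (MvPolynomial σ k)} {f : MvPolynomial σ k}
    (h : map (algebraMap k K) f ∈ I.map (map (algebraMap k K))) : f ∈ I := by
  obtain ⟨l, hl⟩ := LinearMap.exists_leftInverse_of_injective (Algebra.linearMap k K)
    (LinearMap.ker_eq_bot.2 (algebraMap k K).injective)
  have h1 : l 1 = 1 := by simpa using LinearMap.congr_fun hl 1
  have h2 := coeffFunctional_mem l h
  rw [← mul_one (map (algebraMap k K) f), coeffFunctional_map_mul] at h2
  have h3 : coeffFunctional l (1 : MvPolynomial σ K) = 1 := by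
    classical
    ext d
    rw [coeff_coeffFunctional, coeff_one, coeff_one]
    split_ifs <;> simp [h1]
  rwa [h3, mul_one] at h2

end Descent

section Radical

open TensorProduct

/-- Finitely generated subalgebras of `K` are finite separable extensions of `k`, so that they stay
reduced under base change. -/
theorem isReduced_tensorProduct_of_perfectField (k F K : Type*) [Field k] [PerfectField k]
    [Field F] [Algebra k F] [Field K] [Algebra k K] [Algebra.IsAlgebraic k K] :
    IsReduced (F ⊗[k] K) := by
  refine IsReduced.tensorProduct_of_flat_of_forall_fg fun B hB => ?_
  have : Algebra.IsAlgebraic k B := .of_injective B.val Subtype.val_injective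
  let _ : Field B := (Subalgebra.isField_of_algebraic B).toField
  have : Algebra.FiniteType k B := B.fg_iff_finiteType.1 hB
  have : Algebra.IsSeparable k B := inferInstance
  have : Algebra.FormallyUnramified k B := Algebra.FormallyUnramified.of_isSeparable k B
  exact Algebra.FormallyUnramified.isReduced_of_field F (F ⊗[k] B)

variable {σ k K : Type*} [Field k] [Field K] [Algebra k K]

/-- A radical ideal stays radical under an algebraic extension of a perfect field: modulo each
prime `p` over `I`, the extension is the reduced ring `Frac (k[x] / p) ⊗ K`. -/
theorem isRadical_map_of_perfectField [PerfectField k] [Algebra.IsAlgebraic k K]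
    {I : Ideal (MvPolynomial σ k)} (hI : I.IsRadical) :
    (I.map (map (algebraMap k K))).IsRadical := by
  rintro f ⟨n, hn⟩
  let b := Module.Free.chooseBasis k K
  obtain ⟨T, hT⟩ := exists_eq_sum_coeffFunctional b f
  rw [hT]
  refine Ideal.sum_mem _ fun t ht => Ideal.mul_mem_left _ _ (Ideal.mem_map_of_mem _ ?_)
  rw [← hI.radical, Ideal.radical_eq_sInf, Submodule.mem_sInf]
  rintro p ⟨hp, hprime⟩
  let F := FractionRing (MvPolynomial σ k ⧸ p)
  let α : MvPolynomial σ k →ₐ[k] F := (IsScalarTower.toAlgHom k _ F).comp (Ideal.Quotient.mkₐ k p)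
  have hα : ∀ g, α g = 0 ↔ g ∈ p := fun g => by
    rw [← Ideal.Quotient.eq_zero_iff_mem]
    exact map_eq_zero_iff _ (IsFractionRing.injective (MvPolynomial σ k ⧸ p) F)
  let Θ : MvPolynomial σ K →+* F ⊗[k] K :=
    eval₂Hom (Algebra.TensorProduct.includeRight : K →ₐ[k] F ⊗[k] K).toRingHom
      (fun i => α (X i) ⊗ₜ 1)
  have hΘ : ∀ g, Θ (map (algebraMap k K) g) = α g ⊗ₜ 1 := by
    intro g
    have : Θ.comp (map (algebraMap k K)) =
        ((Algebra.TensorProduct.includeLeft : F →ₐ[k] F ⊗[k] K).comp α).toRingHom := by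
      refine ringHom_ext (fun c => ?_) (fun i => ?_)
      · have h1 : α (C c) = algebraMap k F c := α.commutes c
        have h2 : Θ (C (algebraMap k K c)) = (1 : F) ⊗ₜ[k] algebraMap k K c := eval₂Hom_C _ _ _
        have h3 : (algebraMap k F c) ⊗ₜ[k] (1 : K) = (1 : F) ⊗ₜ[k] algebraMap k K c := by
          rw [Algebra.algebraMap_eq_smul_one, Algebra.algebraMap_eq_smul_one, smul_tmul]
        rw [RingHom.comp_apply, map_C, h2, ← h3, ← h1]
        rfl
      · simp [Θ]
    exact RingHom.congr_fun this g
  have hIΘ : I.map (map (algebraMap k K)) ≤ RingHom.ker Θ := by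
    rw [Ideal.map_le_iff_le_comap]
    intro g hg
    rw [Ideal.mem_comap, RingHom.mem_ker, hΘ, (hα g).2 (hp hg), zero_tmul]
  have hred := isReduced_tensorProduct_of_perfectField k F K
  have hf0 : Θ f = 0 := by
    have h1 := hIΘ hn
    rw [RingHom.mem_ker, map_pow] at h1
    exact hred.eq_zero _ ⟨n, h1⟩
  rw [hT, map_sum] at hf0
  have hli := (Algebra.TensorProduct.basis F b).linearIndependent
  rw [linearIndependent_iff'] at hli
  refine (hα _).1 (hli T (fun t => α (coeffFunctional (b.coord t) f)) ?_ t ht)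
  rw [← hf0]
  refine Finset.sum_congr rfl fun s _ => ?_
  rw [map_mul, hΘ]
  simp [Θ, smul_tmul']

end Radical

/-! ### Orthogonal bases in reduced rings -/

/-- Let `E` be a finite-dimensional space of elements of a reduced algebra over an algebraically
closed field such that `E * E ⊆ l * E` for a nonzerodivisor `l`. Then `E` has a basis of pairwise
orthogonal elements: the operators `b ↦ l⁻¹ * a * b` on `E` commute, they are diagonalizable because
the algebra is reduced, and the products of joint eigenvectors of different lines vanish. -/
theorem exists_basis_mul_eq_zero {K E Q : Type*} [Field K] [IsAlgClosed K] [CommRing Q]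
    [Algebra K Q] [IsReduced Q] [AddCommGroup E] [Module K E] [FiniteDimensional K E]
    (θ : E →ₗ[K] Q) (hθ : Function.Injective θ) (l : Q) (hl : ∀ x, l * x = 0 → x = 0)
    (h : ∀ a b, ∃ c, θ a * θ b = l * θ c) :
    ∃ v : Module.Basis (Fin (Module.finrank K E)) K E, ∀ i j, i ≠ j → θ (v i) * θ (v j) = 0 := by
  have cancel : ∀ x y, l * x = l * y → x = y := fun x y hxy =>
    sub_eq_zero.1 (hl _ (by rw [mul_sub, hxy, sub_self]))
  choose T hT using h
  let T' : E → Module.End K E := fun a =>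
    { toFun := T a
      map_add' := fun b c => hθ <| cancel _ _ <| by
        rw [← hT, map_add, map_add, mul_add, mul_add, hT, hT]
      map_smul' := fun r b => hθ <| cancel _ _ <| by
        rw [← hT, map_smul, RingHom.id_apply, map_smul, mul_smul_comm, mul_smul_comm, hT] }
  have hT' : ∀ a b, l * θ (T' a b) = θ a * θ b := fun a b => (hT a b).symm
  have hcomm : Pairwise fun a b => Commute (T' a) (T' b) := by
    intro a b _
    refine LinearMap.ext fun c => hθ <| cancel _ _ <| cancel _ _ ?_
    simp only [Module.End.mul_apply]
    rw [hT', hT', mul_left_comm, hT', mul_left_comm l, hT']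
    ring
  have hpow : ∀ (a : E) (μ : K) (x : E) (n : ℕ),
      l ^ n * θ (((T' a - μ • (1 : Module.End K E)) ^ n) x) =
      (θ a - μ • l) ^ n * θ x := by
    intro a μ x n
    induction n with
    | zero => simp
    | succ n ih =>
      have step : ∀ y, l * θ ((T' a - μ • (1 : Module.End K E)) y) = (θ a - μ • l) * θ y := by
        intro y
        rw [LinearMap.sub_apply, LinearMap.smul_apply, Module.End.one_apply, map_sub, map_smul,
          mul_sub, hT', mul_smul_comm, ← smul_mul_assoc, ← sub_mul]
      rw [pow_succ' (T' a - _), Module.End.mul_apply, pow_succ, mul_assoc, step, mul_left_comm, ih,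
        pow_succ', mul_assoc]
  have hss : ∀ (a : E) (μ : K) (x : E), x ∈ (T' a).maxGenEigenspace μ → T' a x = μ • x := by
    intro a μ x hx
    obtain ⟨n, hn⟩ := Module.End.mem_maxGenEigenspace _ _ _ |>.1 hx
    have h1 : ((θ a - μ • l) * θ x) ^ (n + 1) = 0 := by
      have h0 : (θ a - μ • l) ^ n * θ x = 0 := by rw [← hpow, hn, map_zero, mul_zero]
      have e : ((θ a - μ • l) * θ x) ^ (n + 1) =
          ((θ a - μ • l) ^ n * θ x) * (θ x ^ n * (θ a - μ • l)) := by
        rw [mul_pow, pow_succ, pow_succ]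
        ring
      rw [e, h0, zero_mul]
    have h2 : (θ a - μ • l) * θ x = 0 := IsReduced.eq_zero _ ⟨_, h1⟩
    rw [sub_mul, sub_eq_zero, ← hT', smul_mul_assoc, ← mul_smul_comm, ← map_smul] at h2
    exact hθ (cancel _ _ h2)
  have htop :=
    Module.End.iSup_iInf_maxGenEigenspace_eq_top_of_iSup_maxGenEigenspace_eq_top_of_commute
      T' hcomm fun a => Module.End.iSup_maxGenEigenspace_eq_top (T' a)
  let s : Set E := {x | ∃ χ : E → K, ∀ a, T' a x = χ a • x}
  have hs : Submodule.span K s = ⊤ := by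
    rw [eq_top_iff, ← htop]
    refine iSup_le fun χ x hx => Submodule.subset_span ⟨χ, fun a => hss a _ x ?_⟩
    exact (Submodule.mem_iInf _).1 hx a
  obtain ⟨b, hbs, hb, hli⟩ := exists_linearIndependent K s
  let v := Module.Basis.mk hli (by rw [Subtype.range_coe, hb, hs])
  have hv : ∀ i, v i ∈ s := fun i => by simpa [v] using hbs i.2
  refine ⟨v.reindex (v.indexEquiv (Module.finBasis K E)), fun i j hij => ?_⟩
  rw [Module.Basis.reindex_apply, Module.Basis.reindex_apply]
  generalize hi' : (v.indexEquiv (Module.finBasis K E)).symm i = i'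
  generalize hj' : (v.indexEquiv (Module.finBasis K E)).symm j = j'
  have hne : i' ≠ j' := by
    rintro rfl
    exact hij ((Equiv.injective _) (hi'.trans hj'.symm))
  obtain ⟨χi, hχi⟩ := hv i'
  obtain ⟨χj, hχj⟩ := hv j'
  -- `l⁻¹ * v i * v j` is a multiple of both `v i` and `v j`
  have e1 : χj (v i') • v j' = χi (v j') • v i' := hθ <| cancel _ _ <| by
    rw [← hχi, ← hχj, hT', hT', mul_comm]
  have e2 : χj (v i') = 0 := by
    have := congrArg (fun x => v.repr x j') e1
    simpa [Finsupp.single_apply, hne] using this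
  rw [← hT', hχj, e2, zero_smul, map_zero, mul_zero]

/-! ### Linear forms modulo a radical ideal generated by quadrics -/

section Quadrics

variable {σ K : Type*} [Fintype σ] [Field K]

/-- The maximal ideal is not associated to a radical ideal generated in degrees at least two. -/
theorem mem_of_forall_mul_X_mem {σ K : Type*} [Field K] [Nonempty σ]
    {I : Ideal (MvPolynomial σ K)} (hI : I.IsRadical)
    (hI2 : I ≤ orderIdeal 1 2) {h : MvPolynomial σ K} (hh : ∀ i, h * X i ∈ I) : h ∈ I := by
  have hm : h ∈ Ideal.span (Set.range (X : σ → MvPolynomial σ K)) := by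
    change h ∈ idealOfVars σ K
    rw [← pow_one (idealOfVars σ K), ← orderIdeal_one_eq_idealOfVars_pow]
    let i : σ := Classical.arbitrary σ
    refine mem_orderIdeal_of_mul_mem (f := X i) (m := 1) ?_ ?_
    · rw [mul_comm]
      exact hI2 (hh i)
    · rw [mem_orderIdeal_iff_coeff]
      intro h1
      have := h1 (Finsupp.single i 1) (by simp [weight_one])
      simp at this
  have hsq : ∀ g ∈ Ideal.span (Set.range (X : σ → MvPolynomial σ K)), h * g ∈ I := by
    intro g hg
    induction hg using Submodule.span_induction with
    | mem x hx => obtain ⟨i, rfl⟩ := hx; exact hh i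
    | zero => simp
    | add x y _ _ hx hy => rw [mul_add]; exact add_mem hx hy
    | smul a x _ hx => rw [smul_eq_mul, mul_left_comm]; exact I.mul_mem_left _ hx
  exact hI ⟨2, by rw [pow_two]; exact hsq h hm⟩

theorem exists_X_notMem_of_isAssociatedPrime {σ K : Type*} [Field K] [Finite σ] [Nonempty σ]
    {I : Ideal (MvPolynomial σ K)} (hI : I.IsRadical) (hI2 : I ≤ orderIdeal 1 2)
    {p : Ideal (MvPolynomial σ K)} (hp : IsAssociatedPrime p (MvPolynomial σ K ⧸ I)) :
    ∃ i, X i ∉ p := by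
  obtain ⟨hprime, x, hx⟩ := isAssociatedPrime_iff.1 hp
  obtain ⟨h, rfl⟩ := Ideal.Quotient.mk_surjective x
  by_contra! hX
  have hmem : h ∈ I := mem_of_forall_mul_X_mem hI hI2 fun i => by
    have h1 := hX i
    rw [hx, Submodule.mem_colon_singleton, Submodule.mem_bot] at h1
    rw [← Ideal.Quotient.eq_zero_iff_mem, mul_comm, map_mul]
    exact h1
  refine hprime.ne_top ?_
  rw [hx, Ideal.eq_top_iff_one, Submodule.mem_colon_singleton, one_smul, Submodule.mem_bot]
  exact Ideal.Quotient.eq_zero_iff_mem.2 hmem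

/-- The linear form with given coefficients. -/
noncomputable def linearForm : (σ → K) →ₗ[K] MvPolynomial σ K :=
  Fintype.linearCombination K (X : σ → MvPolynomial σ K)

theorem linearForm_apply (a : σ → K) : linearForm a = ∑ i, a i • (X i : MvPolynomial σ K) := rfl

theorem isHomogeneous_linearForm (a : σ → K) : (linearForm a).IsHomogeneous 1 := by
  rw [linearForm_apply]
  refine IsHomogeneous.sum _ _ _ fun i _ => ?_
  rw [smul_eq_C_mul]
  exact (isHomogeneous_X K i).C_mul _

theorem linearForm_single [DecidableEq σ] (i : σ) : linearForm (Pi.single i (1 : K)) = X i := by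
  simp [linearForm, Fintype.linearCombination_apply_single]

theorem coeff_linearForm (a : σ → K) (i : σ) : coeff (Finsupp.single i 1) (linearForm a) = a i := by
  classical
  simp [linearForm_apply, coeff_sum, coeff_X, Finsupp.single_left_inj]

theorem linearForm_eq_zero_of_mem {I : Ideal (MvPolynomial σ K)} (hI2 : I ≤ orderIdeal 1 2)
    {a : σ → K} (ha : linearForm a ∈ I) : a = 0 := by
  funext i
  rw [← coeff_linearForm a i]
  exact mem_orderIdeal_iff_coeff.1 (hI2 ha) _ (by simp [weight_one])

/-- Over an infinite field some linear form is a nonzerodivisor modulo `I`, because the linear forms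
are not covered by the finitely many associated primes. -/
theorem exists_linearForm_cancel [Infinite K] [Nonempty σ] {I : Ideal (MvPolynomial σ K)}
    (hI : I.IsRadical) (hI2 : I ≤ orderIdeal 1 2) :
    ∃ a : σ → K, ∀ f, linearForm a * f ∈ I → f ∈ I := by
  classical
  let S := MvPolynomial σ K
  have hfin : Finite (associatedPrimes S (S ⧸ I)) := (associatedPrimes.finite S (S ⧸ I)).to_subtype
  let W : associatedPrimes S (S ⧸ I) → Submodule K (σ → K) := fun p =>
    (p.1.restrictScalars K).comap linearForm
  have hW : ⋃ p, (W p : Set (σ → K)) ≠ Set.univ := by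
    intro hcov
    obtain ⟨⟨p, hp⟩, hpt⟩ := Subspace.exists_eq_top_of_iUnion_eq_univ hcov
    obtain ⟨i, hi⟩ := exists_X_notMem_of_isAssociatedPrime hI hI2 hp
    have h1 : Pi.single i (1 : K) ∈ W ⟨p, hp⟩ := hpt ▸ Submodule.mem_top
    have h2 : linearForm (Pi.single i (1 : K)) ∈ p := h1
    rw [linearForm_single] at h2
    exact hi h2
  obtain ⟨a, ha⟩ := (Set.ne_univ_iff_exists_notMem _).1 hW
  refine ⟨a, fun f hf => ?_⟩
  by_contra hfI
  have hz : linearForm a ∈ ⋃ p ∈ associatedPrimes S (S ⧸ I), (p : Set S) := by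
    rw [biUnion_associatedPrimes_eq_zero_divisors]
    exact ⟨Ideal.Quotient.mk I f, fun h => hfI (Ideal.Quotient.eq_zero_iff_mem.1 h),
      (map_mul (Ideal.Quotient.mk I) _ _).symm.trans (Ideal.Quotient.eq_zero_iff_mem.2 hf)⟩
  simp only [Set.mem_iUnion] at hz
  obtain ⟨p, hp, hap⟩ := hz
  exact ha (Set.mem_iUnion.2 ⟨⟨p, hp⟩, hap⟩)

/-- The quadratic forms are spanned by the products of two variables, one for each unordered
pair. -/
theorem finrank_quadrics_le :
    Module.Finite K (homogeneousSubmodule σ K 2) ∧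
    Module.finrank K (homogeneousSubmodule σ K 2) ≤ (Fintype.card σ + 1).choose 2 := by
  classical
  let b : Sym2 σ → MvPolynomial σ K := Sym2.lift ⟨fun i j => X i * X j, fun i j => mul_comm _ _⟩
  have h : homogeneousSubmodule σ K 2 = Submodule.span K (Set.range b) := by
    rw [← homogeneousSubmodule_one_pow, pow_two, homogeneousSubmodule_one_eq_span_X,
      Submodule.span_mul_span]
    congr 1
    ext f
    simp only [Set.mem_mul, Set.mem_range]
    constructor
    · rintro ⟨_, ⟨i, rfl⟩, _, ⟨j, rfl⟩, rfl⟩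
      exact ⟨s(i, j), rfl⟩
    · rintro ⟨z, rfl⟩
      induction z with
      | _ i j => exact ⟨_, ⟨i, rfl⟩, _, ⟨j, rfl⟩, rfl⟩
  rw [h, ← Sym2.card]
  exact ⟨Module.Finite.span_of_finite K (Set.finite_range b), finrank_range_le_card b⟩

/-- If `I` contains enough quadrics, the products of linear forms are multiples of a
nonzerodivisor `l`: multiplication by `l` embeds the linear forms into the quadrics modulo `I`, which
form a space of dimension at most the number of variables. -/
theorem exists_linearForm_mul_sub_mem {ι : Type*} [Fintype ι] {I : Ideal (MvPolynomial σ K)}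
    (hI2 : I ≤ orderIdeal 1 2) (q : ι → MvPolynomial σ K)
    (hcard : Fintype.card ι = (Fintype.card σ).choose 2) (hq : LinearIndependent K q)
    (hqI : ∀ i, q i ∈ I) (hq2 : ∀ i, (q i).IsHomogeneous 2) {l : σ → K}
    (hl : ∀ f, linearForm l * f ∈ I → f ∈ I) (a b : σ → K) :
    ∃ c, linearForm a * linearForm b - linearForm l * linearForm c ∈ I := by
  obtain ⟨hfin, hrank⟩ := finrank_quadrics_le (σ := σ) (K := K)
  let π : homogeneousSubmodule σ K 2 →ₗ[K] MvPolynomial σ K ⧸ I :=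
    (Ideal.Quotient.mkₐ K I).toLinearMap ∘ₗ (homogeneousSubmodule σ K 2).subtype
  have hker : (Fintype.card σ).choose 2 ≤ Module.finrank K (LinearMap.ker π) := by
    let q' : ι → LinearMap.ker π := fun i =>
      ⟨⟨q i, hq2 i⟩, Ideal.Quotient.eq_zero_iff_mem.2 (hqI i)⟩
    have hq' : LinearIndependent K q' := by
      refine LinearIndependent.of_comp
        ((homogeneousSubmodule σ K 2).subtype ∘ₗ (LinearMap.ker π).subtype) ?_
      exact hq
    rw [← hcard]
    exact hq'.fintype_card_le_finrank
  have hrange : Module.finrank K (LinearMap.range π) ≤ Fintype.card σ := by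
    have h1 := LinearMap.finrank_range_add_finrank_ker π
    have h2 : (Fintype.card σ + 1).choose 2 = Fintype.card σ + (Fintype.card σ).choose 2 := by
      rw [Nat.choose_succ_succ' _ 1, Nat.choose_one_right]
    omega
  have hprod : ∀ a b : σ → K, Ideal.Quotient.mk I (linearForm a * linearForm b) ∈
      LinearMap.range π := fun a b =>
    ⟨⟨_, (isHomogeneous_linearForm a).mul (isHomogeneous_linearForm b)⟩, rfl⟩
  let μ : (σ → K) →ₗ[K] LinearMap.range π :=
    LinearMap.codRestrict _ ((Ideal.Quotient.mkₐ K I).toLinearMap ∘ₗ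
      LinearMap.mulLeft K (linearForm l) ∘ₗ linearForm) (hprod l)
  have hμ : Function.Injective μ := by
    rw [injective_iff_map_eq_zero]
    intro c hc
    have h1 : Ideal.Quotient.mk I (linearForm l * linearForm c) = 0 := congrArg Subtype.val hc
    exact linearForm_eq_zero_of_mem hI2 (hl _ (Ideal.Quotient.eq_zero_iff_mem.1 h1))
  have hμs : Function.Surjective μ := by
    refine (LinearMap.injective_iff_surjective_of_finrank_eq_finrank ?_).1 hμ
    refine le_antisymm (LinearMap.finrank_le_finrank_of_injective hμ) ?_
    rwa [Module.finrank_fintype_fun_eq_card]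
  obtain ⟨c, hc⟩ := hμs ⟨_, hprod a b⟩
  exact ⟨c, Ideal.Quotient.eq.1 (congrArg Subtype.val hc).symm⟩

/-- The substitution of variables induced by a linear map on the space of linear forms. -/
noncomputable def linearSubst (T : (σ → K) →ₗ[K] (σ → K)) :
    MvPolynomial σ K →ₐ[K] MvPolynomial σ K :=
  open scoped Classical in aeval fun i => linearForm (T (Pi.single i 1))

theorem linearSubst_X [DecidableEq σ] (T : (σ → K) →ₗ[K] (σ → K)) (i : σ) :
    linearSubst T (X i) = linearForm (T (Pi.single i 1)) := by
  rw [linearSubst, aeval_X]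
  congr!

theorem linearSubst_linearForm (T : (σ → K) →ₗ[K] (σ → K)) (a : σ → K) :
    linearSubst T (linearForm a) = linearForm (T a) := by
  classical
  have : (linearSubst T).toLinearMap ∘ₗ linearForm = linearForm ∘ₗ T := by
    refine LinearMap.pi_ext' fun i => LinearMap.ext_ring ?_
    change linearSubst T (linearForm (Pi.single i 1)) = linearForm (T (Pi.single i 1))
    rw [linearForm_single, linearSubst_X]
  exact LinearMap.congr_fun this a

theorem linearSubst_comp (T U : (σ → K) →ₗ[K] (σ → K)) :
    (linearSubst T).comp (linearSubst U) = linearSubst (T ∘ₗ U) := by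
  classical
  refine algHom_ext fun i => ?_
  rw [AlgHom.comp_apply, linearSubst_X, linearSubst_X, linearSubst_linearForm, LinearMap.comp_apply]

theorem linearSubst_id : linearSubst (LinearMap.id : (σ → K) →ₗ[K] (σ → K)) = AlgHom.id K _ := by
  classical
  refine algHom_ext fun i => ?_
  rw [linearSubst_X, LinearMap.id_apply, linearForm_single, AlgHom.id_apply]

/-- A quadric in a radical ideal that contains all `X i * X j` with `i ≠ j` but no variable has no
square terms: `X i` times the quadric is congruent to a multiple of `X i ^ 3`. -/
theorem mem_coordinatePointsIdeal_of_quadric {I : Ideal (MvPolynomial σ K)}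
    (hI : I.IsRadical) (hJ : coordinatePointsIdeal σ K ≤ I)
    (hX : ∀ i, (X i : MvPolynomial σ K) ∉ I) {f : MvPolynomial σ K} (hf : f.IsHomogeneous 2)
    (hfI : f ∈ I) : f ∈ coordinatePointsIdeal σ K := by
  classical
  rw [← pow_one (coordinatePointsIdeal σ K)]
  refine mem_coordinatePointsIdeal_pow (mem_orderIdeal_of_isHomogeneous hf) fun i => ?_
  set c := coeff (Finsupp.single i 2) f with hc
  have hX2 : (X i ^ 2 : MvPolynomial σ K).IsHomogeneous 2 := isHomogeneous_X_pow i 2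
  have hg2 : f - C c * X i ^ 2 ∈ orderIdeal 1 2 :=
    sub_mem (mem_orderIdeal_of_isHomogeneous hf) (mem_orderIdeal_of_isHomogeneous (hX2.C_mul c))
  have hgi : f - C c * X i ^ 2 ∈ orderIdeal (axisWeight i) 1 := by
    rw [mem_orderIdeal_iff_coeff]
    intro d hd
    have hw : Finsupp.weight (axisWeight i) d = 0 := by omega
    by_cases hdi : d = Finsupp.single i 2
    · rw [hdi, coeff_sub, coeff_C_mul, coeff_X_pow, ← hc]
      simp
    · have hdeg : d.degree ≠ 2 := by
        intro h2
        refine hdi (Finsupp.ext fun j => ?_)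
        by_cases hji : j = i
        · subst hji
          have := weight_axisWeight_add j d
          rw [Finsupp.single_eq_same]
          omega
        · have := Finsupp.le_weight (axisWeight i) (s := j) (by simp [axisWeight, hji]) d
          rw [Finsupp.single_eq_of_ne hji]
          omega
      exact (hf.sub (hX2.C_mul c)).coeff_eq_zero hdeg
  -- `f - c * X i ^ 2` vanishes on the `i`-th axis, and `X i` vanishes on the others
  have hXg : X i * (f - C c * X i ^ 2) ∈ coordinatePointsIdeal σ K := by
    rw [← pow_one (coordinatePointsIdeal σ K)]
    refine mem_coordinatePointsIdeal_pow (Ideal.mul_mem_left _ _ hg2) fun j => ?_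
    by_cases hij : i = j
    · exact Ideal.mul_mem_left _ _ (hij ▸ hgi)
    · refine Ideal.mul_mem_right _ _ ?_
      have := X_mem_orderIdeal (K := K) (w := axisWeight j) i
      rwa [axisWeight, if_neg hij] at this
  have hcX : C c * X i ^ 3 ∈ I := by
    have := sub_mem (I.mul_mem_left (X i) hfI) (hJ hXg)
    convert this using 1
    ring
  have hc0 : c = 0 := by
    by_contra hc0
    refine hX i (hI ⟨3, ?_⟩)
    have := I.mul_mem_left (C c⁻¹) hcX
    rwa [← mul_assoc, ← C_mul, inv_mul_cancel₀ hc0, C_1, one_mul] at this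
  simpa [hc0] using hgi

/-- A radical ideal over an algebraically closed field that is generated by `N choose 2` linearly
independent quadrics in `N` variables is the ideal of the `N` coordinate points, up to a linear
change of coordinates. -/
theorem exists_algEquiv_map_coordinatePointsIdeal [IsAlgClosed K] [Nonempty σ] {ι : Type*}
    [Fintype ι] {I : Ideal (MvPolynomial σ K)} (hI : I.IsRadical) (q : ι → MvPolynomial σ K)
    (hcard : Fintype.card ι = (Fintype.card σ).choose 2) (hq : LinearIndependent K q)
    (hq2 : ∀ i, (q i).IsHomogeneous 2) (hqI : I = Ideal.span (Set.range q)) :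
    ∃ ψ : MvPolynomial σ K ≃ₐ[K] MvPolynomial σ K, (∀ i, (ψ (X i)).IsHomogeneous 1) ∧
      (∀ i, (ψ.symm (X i)).IsHomogeneous 1) ∧ (coordinatePointsIdeal σ K).map ψ = I := by
  classical
  have hqmem : ∀ i, q i ∈ I := fun i => hqI ▸ Ideal.subset_span ⟨i, rfl⟩
  have hI2 : I ≤ orderIdeal 1 2 := by
    rw [hqI, Ideal.span_le]
    rintro _ ⟨i, rfl⟩
    exact mem_orderIdeal_of_isHomogeneous (hq2 i)
  have : Infinite K := IsAlgClosed.instInfinite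
  obtain ⟨l, hl⟩ := exists_linearForm_cancel hI hI2
  let θ : (σ → K) →ₗ[K] MvPolynomial σ K ⧸ I := (Ideal.Quotient.mkₐ K I).toLinearMap ∘ₗ linearForm
  have hθ : Function.Injective θ := by
    rw [injective_iff_map_eq_zero]
    exact fun a ha => linearForm_eq_zero_of_mem hI2 (Ideal.Quotient.eq_zero_iff_mem.1 ha)
  have : IsReduced (MvPolynomial σ K ⧸ I) := (Ideal.isRadical_iff_quotient_reduced I).1 hI
  obtain ⟨v', hv'⟩ := exists_basis_mul_eq_zero θ hθ (Ideal.Quotient.mk I (linearForm l))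
    (fun x hx => by
      obtain ⟨f, rfl⟩ := Ideal.Quotient.mk_surjective x
      rw [← map_mul, Ideal.Quotient.eq_zero_iff_mem] at hx
      exact Ideal.Quotient.eq_zero_iff_mem.2 (hl f hx))
    (fun a b => by
      obtain ⟨c, hc⟩ := exists_linearForm_mul_sub_mem hI2 q hcard hq hqmem hq2 hl a b
      exact ⟨c, Ideal.Quotient.eq.2 hc⟩)
  let e : Fin (Module.finrank K (σ → K)) ≃ σ := v'.indexEquiv (Pi.basisFun K σ)
  let v := v'.reindex e
  have hv : ∀ i j, i ≠ j → linearForm (v i) * linearForm (v j) ∈ I := fun i j hij => by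
    rw [← Ideal.Quotient.eq_zero_iff_mem, map_mul]
    have := hv' (e.symm i) (e.symm j) (fun h => hij (e.symm.injective h))
    rw [Module.Basis.reindex_apply, Module.Basis.reindex_apply]
    exact this
  have hsub : ∀ i, linearSubst v.equivFun.symm.toLinearMap (X i) = linearForm (v i) := fun i => by
    rw [linearSubst_X]
    simp
  let ψ : MvPolynomial σ K ≃ₐ[K] MvPolynomial σ K :=
    AlgEquiv.ofAlgHom (linearSubst v.equivFun.symm.toLinearMap) (linearSubst v.equivFun.toLinearMap)
      (by
        rw [linearSubst_comp, LinearEquiv.comp_coe, LinearEquiv.self_trans_symm]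
        exact linearSubst_id)
      (by
        rw [linearSubst_comp, LinearEquiv.comp_coe, LinearEquiv.symm_trans_self]
        exact linearSubst_id)
  have hψX : ∀ i, ψ (X i) = linearForm (v i) := hsub
  have hψX' : ∀ i, (ψ.symm (X i)).IsHomogeneous 1 := fun i => by
    change (linearSubst v.equivFun.toLinearMap (X i)).IsHomogeneous 1
    rw [linearSubst_X]
    exact isHomogeneous_linearForm _
  have hJI : (coordinatePointsIdeal σ K).map ψ ≤ I := by
    rw [Ideal.map_le_iff_le_comap, coordinatePointsIdeal, Ideal.span_le]
    rintro _ ⟨i, j, hij, rfl⟩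
    change ψ (X i * X j) ∈ I
    rw [map_mul, hψX, hψX]
    exact hv i j hij
  refine ⟨ψ, fun i => hψX i ▸ isHomogeneous_linearForm _, hψX', le_antisymm hJI ?_⟩
  rw [hqI, Ideal.span_le]
  rintro _ ⟨t, rfl⟩
  have hmem : ψ.symm (q t) ∈ I.comap ψ := by
    rw [Ideal.mem_comap, AlgEquiv.apply_symm_apply]
    exact hqmem t
  have hhom : (ψ.symm (q t)).IsHomogeneous 2 := by
    rw [← aeval_X_left_apply (q t), ← AlgEquiv.coe_toAlgHom, ← AlgHom.comp_apply, comp_aeval]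
    exact (hq2 t).aeval _ hψX'
  have h1 := mem_coordinatePointsIdeal_of_quadric (hI.comap ψ)
    (Ideal.map_le_iff_le_comap.1 hJI) (fun i hi => ?_) hhom hmem
  · rw [← ψ.apply_symm_apply (q t)]
    exact Ideal.mem_map_of_mem ψ h1
  · rw [Ideal.mem_comap, hψX] at hi
    exact v.ne_zero i (linearForm_eq_zero_of_mem hI2 hi)

end Quadrics

/-! ### Coordinates over the algebraic closure -/

/-- A generator in the span of the others could be omitted. -/
theorem linearIndependent_of_isMinimalGeneratingSet {k S : Type*} [Field k] [CommRing S]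
    [Algebra k S] {I : Ideal S} {G : Finset S} (h : IsMinimalGeneratingSet I G) :
    LinearIndependent k ((↑) : G → S) := by
  classical
  rw [linearIndependent_iff_notMem_span]
  rintro ⟨g, hg⟩ hmem
  refine h.2 (G.erase g) (Finset.erase_ssubset hg) ?_
  rw [← h.1]
  refine le_antisymm (Ideal.span_mono (by simp)) (Ideal.span_le.2 fun x hx => ?_)
  by_cases hxg : x = g
  · subst hxg
    refine Submodule.span_le_restrictScalars k S _ (Submodule.span_mono ?_ hmem)
    rintro _ ⟨⟨y, hy⟩, hy', rfl⟩
    simp only [Set.mem_sdiff, Set.mem_univ, Set.mem_singleton_iff, true_and, Subtype.mk.injEq] at hy'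
    simp [hy, hy']
  · exact Ideal.subset_span (by simpa [hxg] using hx)

section Extension

variable {σ k K : Type*} [Field k] [Field K] [Algebra k K]

theorem coeffFunctional_smul_map (l : K →ₗ[k] k) (c : K) (f : MvPolynomial σ k) :
    coeffFunctional l (c • map (algebraMap k K) f) = l c • f := by
  ext d
  rw [coeff_coeffFunctional, coeff_smul, coeff_smul, coeff_map, smul_eq_mul, mul_comm,
    ← Algebra.smul_def, map_smul, smul_eq_mul, smul_eq_mul, mul_comm]

theorem linearIndependent_map {ι : Type*} {q : ι → MvPolynomial σ k}
    (hq : LinearIndependent k q) :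
    LinearIndependent K fun i => map (algebraMap k K) (q i) := by
  rw [linearIndependent_iff'] at hq ⊢
  intro s c hc i hi
  rw [← Module.forall_dual_apply_eq_zero_iff k]
  intro l
  refine hq s (fun i => l (c i)) ?_ i hi
  have h := congrArg (coeffFunctional l) hc
  simpa only [map_sum, coeffFunctional_smul_map, map_zero] using h

/-- Over an algebraically closed extension of a perfect field, the ideal is the ideal of the
coordinate points up to a linear change of coordinates. -/
theorem exists_algEquiv_map_eq_map {N : ℕ} (hN : 3 ≤ N) [PerfectField k] [IsAlgClosed K]
    [Algebra.IsAlgebraic k K] {I : Ideal (MvPolynomial (Fin N) k)} (hI : I.IsRadical)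
    (hgen : IsMinimallyGeneratedByQuadrics I (N.choose 2)) :
    ∃ ψ : MvPolynomial (Fin N) K ≃ₐ[K] MvPolynomial (Fin N) K,
      (∀ i, (ψ (X i)).IsHomogeneous 1) ∧ (∀ i, (ψ.symm (X i)).IsHomogeneous 1) ∧
      (coordinatePointsIdeal (Fin N) K).map ψ = I.map (map (algebraMap k K)) := by
  obtain ⟨G, hcard, hG2, hG⟩ := hgen
  have : Nonempty (Fin N) := ⟨⟨0, by omega⟩⟩
  refine exists_algEquiv_map_coordinatePointsIdeal (isRadical_map_of_perfectField hI)
    (fun g : G => map (algebraMap k K) g.1) (by simp [hcard])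
    (linearIndependent_map (linearIndependent_of_isMinimalGeneratingSet hG))
    (fun g => (hG2 g.1 g.2).map _) ?_
  rw [← hG.1, Ideal.map_span]
  congr 1
  ext f
  simp

end Extension

/-! ### Symbolic powers -/

section Symbolic

theorem mem_symbolicPower {S : Type*} [CommRing S] {I : Ideal S} {m : ℕ} {f : S} :
    f ∈ symbolicPower I m ↔
      ∀ p : Ideal S, IsAssociatedPrime p (S ⧸ I) → ∃ s ∉ p, s * f ∈ I ^ m := by
  rw [symbolicPower, Submodule.mem_iInf, Subtype.forall]
  refine forall₂_congr fun p hp => ?_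
  have := hp.isPrime
  rw [Ideal.mem_comap, IsLocalization.algebraMap_mem_map_algebraMap_iff p.primeCompl]
  rfl

theorem mem_annihilator_symbolicPowerQuotient {S : Type*} [CommRing S] {I : Ideal S} {m : ℕ}
    {f : S} : f ∈ Module.annihilator S (SymbolicPowerQuotient I m) ↔
      ∀ g ∈ symbolicPower I m, f * g ∈ I ^ m := by
  rw [Module.mem_annihilator]
  constructor
  · intro h g hg
    have := h (Submodule.Quotient.mk ⟨g, hg⟩)
    rw [← Submodule.Quotient.mk_smul, Submodule.Quotient.mk_eq_zero] at this
    exact this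
  · rintro h ⟨g⟩
    exact (Submodule.Quotient.mk_eq_zero _).2 (h g.1 g.2)

/-- A polynomial that a power of the irrelevant maximal ideal multiplies into `I ^ m` lies in the
symbolic power, since no associated prime of `I` contains all variables. -/
theorem mem_symbolicPower_of_forall_mul_mem {σ k : Type*} [Field k] [Finite σ] [Nonempty σ]
    {I : Ideal (MvPolynomial σ k)} (hI : I.IsRadical) (hI2 : I ≤ orderIdeal 1 2) {m e : ℕ}
    {g : MvPolynomial σ k} (hg : ∀ f ∈ idealOfVars σ k ^ e, f * g ∈ I ^ m) :
    g ∈ symbolicPower I m := by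
  rw [mem_symbolicPower]
  intro p hp
  have hprime := hp.isPrime
  obtain ⟨i, hi⟩ := exists_X_notMem_of_isAssociatedPrime hI hI2 hp
  exact ⟨X i ^ e, fun h => hi (hprime.mem_of_pow_mem _ h),
    hg _ (Ideal.pow_mem_pow (Ideal.subset_span (Set.mem_range_self i)) e)⟩

end Symbolic

/-- An element of `I^(m)` of order at most `2 * m - e` is not multiplied into `I ^ m` by any element
of order less than `e`, because `I ^ m` has order at least `2 * m`. -/
theorem annihilator_le_pow_idealOfVars {σ k : Type*} [Field k]
    {I : Ideal (MvPolynomial σ k)} (hI2 : I ≤ orderIdeal 1 2) {m e : ℕ} (he : e ≤ 2 * m)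
    {g : MvPolynomial σ k} (hg : g ∈ symbolicPower I m) (hord : g ∉ orderIdeal 1 (2 * m - e + 1)) :
    Module.annihilator (MvPolynomial σ k) (SymbolicPowerQuotient I m) ≤ idealOfVars σ k ^ e := by
  intro f hf
  rw [mem_annihilator_symbolicPowerQuotient] at hf
  rw [← orderIdeal_one_eq_idealOfVars_pow]
  have h1 := pow_le_orderIdeal hI2 m (hf g hg)
  rw [mul_comm f g] at h1
  exact mem_orderIdeal_of_mul_mem (orderIdeal_anti (by omega) h1) hord

/-! ### Comparison with the coordinate points -/

section CoordinatePoints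

variable {σ k K : Type*} [Field k] [Field K] [Algebra k K]
  {I : Ideal (MvPolynomial σ k)} {ψ : MvPolynomial σ K ≃ₐ[K] MvPolynomial σ K}

theorem symm_map_mem_pow (hJ : (coordinatePointsIdeal σ K).map ψ = I.map (map (algebraMap k K)))
    {m : ℕ} {f : MvPolynomial σ k} (hf : f ∈ I ^ m) :
    ψ.symm (map (algebraMap k K) f) ∈ coordinatePointsIdeal σ K ^ m := by
  have h1 := Ideal.mem_map_of_mem (map (algebraMap k K)) hf
  rw [Ideal.map_pow, ← hJ, ← Ideal.map_pow, Ideal.mem_map_of_equiv] at h1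
  obtain ⟨x, hx, hx'⟩ := h1
  rw [← hx']
  simpa using hx

theorem map_mem_map_pow (hJ : (coordinatePointsIdeal σ K).map ψ = I.map (map (algebraMap k K)))
    {m : ℕ} {f : MvPolynomial σ K} (hf : ψ.symm f ∈ coordinatePointsIdeal σ K ^ m) :
    f ∈ (I ^ m).map (map (algebraMap k K)) := by
  have h1 := Ideal.mem_map_of_mem ψ hf
  rwa [Ideal.map_pow, hJ, ← Ideal.map_pow, AlgEquiv.apply_symm_apply] at h1

theorem symm_map_mem_orderIdeal (hψ : ∀ i, (ψ.symm (X i)).IsHomogeneous 1) {n : ℕ}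
    {f : MvPolynomial σ k} (hf : f ∈ idealOfVars σ k ^ n) :
    ψ.symm (map (algebraMap k K) f) ∈ orderIdeal 1 n := by
  let Φ : MvPolynomial σ k →+* MvPolynomial σ K :=
    (ψ.symm : MvPolynomial σ K →+* MvPolynomial σ K).comp (map (algebraMap k K))
  have h1 : (idealOfVars σ k).map Φ ≤ orderIdeal 1 1 := by
    rw [idealOfVars, Ideal.map_span, Ideal.span_le]
    rintro _ ⟨_, ⟨i, rfl⟩, rfl⟩
    refine mem_orderIdeal_of_isHomogeneous ?_
    simpa [Φ] using hψ i
  have h2 := pow_le_orderIdeal h1 n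
  rw [← Ideal.map_pow, mul_one] at h2
  exact h2 (Ideal.mem_map_of_mem Φ hf)

variable [Fintype σ] [DecidableEq σ]

/-- The prime of the `i`-th axis contracts to an associated prime of `I`. It is the annihilator
of any coefficientwise functional of the `i`-th coordinate that does not vanish on the axis. -/
theorem isAssociatedPrime_comap_axis
    (hJ : (coordinatePointsIdeal σ K).map ψ = I.map (map (algebraMap k K))) (i : σ) :
    IsAssociatedPrime (((orderIdeal (axisWeight i) 1).comap ψ.symm).comap (map (algebraMap k K)))
      (MvPolynomial σ k ⧸ I) := by
  have hprime : (orderIdeal (axisWeight i) 1 : Ideal (MvPolynomial σ K)).IsPrime :=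
    orderIdeal_one_isPrime
  have hXi : (X i : MvPolynomial σ K) ∉ orderIdeal (axisWeight i) 1 := by
    rw [mem_orderIdeal_iff_coeff]
    intro h
    have := h (Finsupp.single i 1) (by simp [Finsupp.weight_single, axisWeight])
    simp at this
  obtain ⟨l, hl⟩ := exists_coeffFunctional_notMem (k := k)
    (P := (orderIdeal (axisWeight i) 1).comap ψ.symm) (f := ψ (X i))
    (by rwa [Ideal.mem_comap, AlgEquiv.symm_apply_apply])
  refine isAssociatedPrime_iff.2 ⟨inferInstance,
    Ideal.Quotient.mk I (coeffFunctional l (ψ (X i))), ?_⟩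
  ext s
  have hcolon : s ∈ Submodule.colon (⊥ : Submodule (MvPolynomial σ k) (MvPolynomial σ k ⧸ I))
      {Ideal.Quotient.mk I (coeffFunctional l (ψ (X i)))} ↔
      s * coeffFunctional l (ψ (X i)) ∈ I := by
    rw [Submodule.mem_colon_singleton, Submodule.mem_bot, ← Ideal.Quotient.eq_zero_iff_mem]
    rfl
  rw [hcolon, Ideal.mem_comap, Ideal.mem_comap]
  constructor
  · intro hs
    rw [← coeffFunctional_map_mul]
    refine coeffFunctional_mem l ?_
    rw [← pow_one I]
    refine map_mem_map_pow hJ (mem_coordinatePointsIdeal_pow ?_ fun j => ?_)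
    · rw [map_mul, AlgEquiv.symm_apply_apply]
      refine mul_mem_orderIdeal (m := 1) (n := 1) ?_ (X_mem_orderIdeal (w := 1) i)
      rw [mem_orderIdeal_iff_support] at hs ⊢
      intro d hd
      have h1 := hs d hd
      have h2 := weight_axisWeight_add i d
      rw [weight_one]
      omega
    · rw [map_mul, AlgEquiv.symm_apply_apply]
      by_cases hij : i = j
      · exact Ideal.mul_mem_right _ _ (hij ▸ hs)
      · refine Ideal.mul_mem_left _ _ ?_
        have := X_mem_orderIdeal (K := K) (w := axisWeight j) i
        rwa [axisWeight, if_neg hij] at this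
  · intro hs
    rw [← pow_one I] at hs
    have h1 := symm_map_mem_pow hJ hs
    rw [pow_one, map_mul, map_mul] at h1
    exact (hprime.mem_or_mem (coordinatePointsIdeal_le_axis i h1)).resolve_right hl

/-- Elements of the symbolic power vanish to order `m` along every axis. -/
theorem symm_map_mem_axis_of_mem_symbolicPower
    (hJ : (coordinatePointsIdeal σ K).map ψ = I.map (map (algebraMap k K))) {m : ℕ}
    {f : MvPolynomial σ k} (hf : f ∈ symbolicPower I m) (i : σ) :
    ψ.symm (map (algebraMap k K) f) ∈ orderIdeal (axisWeight i) m := by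
  obtain ⟨s, hs, hsf⟩ := mem_symbolicPower.1 hf _ (isAssociatedPrime_comap_axis hJ i)
  have h1 := pow_le_orderIdeal (coordinatePointsIdeal_le_axis i) m (symm_map_mem_pow hJ hsf)
  rw [map_mul, map_mul] at h1
  exact mem_orderIdeal_of_mul_mem (m := 0) (by simpa using h1) hs

/-- The hypothesis `he` says that `2 * m - e` is at most `N * m / (N - 1)`, the least possible degree
of an element of the symbolic power. -/
theorem pow_idealOfVars_le_annihilator
    (hψ : ∀ i, (ψ.symm (X i)).IsHomogeneous 1)
    (hJ : (coordinatePointsIdeal σ K).map ψ = I.map (map (algebraMap k K))) {m e : ℕ}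
    (he : ∀ a, Fintype.card σ * m + a ≤ Fintype.card σ * a → 2 * m - e ≤ a) :
    idealOfVars σ k ^ e ≤ Module.annihilator (MvPolynomial σ k) (SymbolicPowerQuotient I m) := by
  intro f hf
  rw [mem_annihilator_symbolicPowerQuotient]
  intro h hh
  refine mem_of_map_mem (K := K) (map_mem_map_pow hJ ?_)
  have hax := symm_map_mem_axis_of_mem_symbolicPower hJ hh
  rw [map_mul, map_mul]
  refine mem_coordinatePointsIdeal_pow ?_ fun i => Ideal.mul_mem_left _ _ (hax i)
  exact orderIdeal_anti (by omega)
    (mul_mem_orderIdeal (symm_map_mem_orderIdeal hψ hf) (mem_orderIdeal_one_of_axis hax he))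

/-- If some monomial of degree `2 * m - e` vanishes to order `m` along all axes, then a nonzero form
of that degree is multiplied into `I ^ m` by all polynomials of order `e`. It is a coefficientwise
functional of the monomial. -/
theorem exists_form_forall_mul_mem
    (hψ : ∀ i, (ψ (X i)).IsHomogeneous 1) (hψ' : ∀ i, (ψ.symm (X i)).IsHomogeneous 1)
    (hJ : (coordinatePointsIdeal σ K).map ψ = I.map (map (algebraMap k K))) {m e : ℕ}
    (he : e ≤ m) (d : σ →₀ ℕ) (hd : d.degree = 2 * m - e) (hdi : ∀ i, d i ≤ m - e) :
    ∃ g ∉ orderIdeal 1 (2 * m - e + 1), ∀ f ∈ idealOfVars σ k ^ e, f * g ∈ I ^ m := by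
  obtain ⟨u, hu0, hu, hui⟩ : ∃ u : MvPolynomial σ K, u ≠ 0 ∧ u.IsHomogeneous (2 * m - e) ∧
      ∀ i, u ∈ orderIdeal (axisWeight i) m := by
    refine ⟨monomial d 1, by simp, isHomogeneous_monomial _ hd, fun i => ?_⟩
    rw [mem_orderIdeal_iff_support]
    intro x hx
    obtain rfl : x = d := by simpa using support_monomial_subset hx
    have h1 := weight_axisWeight_add i x
    have h2 := hdi i
    omega
  have hψu : (ψ u).IsHomogeneous (2 * m - e) := by
    rw [← aeval_X_left_apply u, ← AlgEquiv.coe_toAlgHom, ← AlgHom.comp_apply, comp_aeval,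
      ← one_mul (2 * m - e)]
    exact hu.aeval _ hψ
  have hψu0 : ψ u ∉ (⊥ : Ideal (MvPolynomial σ K)) := by
    rwa [Ideal.mem_bot, EmbeddingLike.map_eq_zero_iff]
  obtain ⟨l, hl⟩ := exists_coeffFunctional_notMem (k := k) hψu0
  refine ⟨coeffFunctional l (ψ u), fun h => hl ?_, fun f hf => ?_⟩
  · rw [mem_orderIdeal_iff_coeff] at h
    have h0 : coeffFunctional l (ψ u) = 0 := by
      ext x
      by_cases hx : x.degree = 2 * m - e
      · rw [h x (by rw [weight_one]; omega), coeff_zero]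
      · rw [coeff_coeffFunctional, hψu.coeff_eq_zero hx, map_zero, coeff_zero]
    rw [h0, map_zero]
    exact zero_mem _
  · rw [← coeffFunctional_map_mul]
    refine coeffFunctional_mem l (map_mem_map_pow hJ ?_)
    rw [map_mul, AlgEquiv.symm_apply_apply]
    exact mem_coordinatePointsIdeal_pow (orderIdeal_anti (by omega)
      (mul_mem_orderIdeal (symm_map_mem_orderIdeal hψ' hf) (mem_orderIdeal_of_isHomogeneous hu)))
      fun i => Ideal.mul_mem_left _ _ (hui i)

end CoordinatePoints

theorem floor_mul_sub_two_div {N : ℕ} (hN : 3 ≤ N) (m : ℕ) :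
    ⌊((m : ℚ) * ((N : ℚ) - 2)) / ((N : ℚ) - 1)⌋₊ = m * (N - 2) / (N - 1) := by
  rw [← Nat.floor_div_eq_div (K := ℚ)]
  push_cast [Nat.cast_sub (show 2 ≤ N by omega), Nat.cast_sub (show 1 ≤ N by omega)]
  rfl

theorem theorem5p4 {k : Type*} [Field k] [PerfectField k] (N : ℕ) (hN : 3 ≤ N)
    (I : Ideal (MvPolynomial (Fin N) k)) (hrad : I.IsRadical)
    (hhom : I.IsHomogeneous (homogeneousSubmodule (Fin N) k))
    (hht : I.height = ((N - 1 : ℕ) : ℕ∞))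
    (hgen : IsMinimallyGeneratedByQuadrics I (N.choose 2))
    (m : ℕ) (hm : 1 ≤ m) :
    Module.annihilator (MvPolynomial (Fin N) k) (SymbolicPowerQuotient I m) =
      (Ideal.span (Set.range (X : Fin N → MvPolynomial (Fin N) k))) ^
        ⌊((m : ℚ) * ((N : ℚ) - 2)) / ((N : ℚ) - 1)⌋₊ := by
  obtain ⟨ψ, hψ, hψ', hJ⟩ := exists_algEquiv_map_eq_map (K := AlgebraicClosure k) hN hrad hgen
  have hI2 : I ≤ orderIdeal 1 2 := by
    obtain ⟨G, -, hG2, hG⟩ := hgen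
    rw [← hG.1, Ideal.span_le]
    exact fun g hg => mem_orderIdeal_of_isHomogeneous (hG2 g hg)
  have : Nonempty (Fin N) := ⟨⟨0, by omega⟩⟩
  rw [floor_mul_sub_two_div hN]
  change _ = idealOfVars (Fin N) k ^ _
  obtain ⟨n, rfl⟩ : ∃ n, N = n + 2 := ⟨N - 2, by omega⟩
  simp only [Nat.add_sub_cancel, show n + 2 - 1 = n + 1 by omega]
  -- `e` is the integer part of `m * n / (n + 1)`, and only its two defining inequalities matter
  have he1 : m * n / (n + 1) * (n + 1) ≤ m * n := Nat.div_mul_le_self _ _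
  have he2 : ∀ x, x * (n + 1) ≤ m * n → x ≤ m * n / (n + 1) := fun x hx =>
    (Nat.le_div_iff_mul_le (by omega)).2 hx
  generalize m * n / (n + 1) = e at *
  have hem : e ≤ m := by
    by_contra! h
    nlinarith
  obtain ⟨t, rfl⟩ := exists_add_of_le hem
  refine le_antisymm ?_ (pow_idealOfVars_le_annihilator hψ' hJ fun a ha => ?_)
  -- with `m = e + t`, a monomial of degree `2 * m - e` with all exponents at most `t = m - e`
  · obtain ⟨a, ha, hsum⟩ := exists_sum_eq_of_le_mul (n + 2) t (e + 2 * t) (by nlinarith)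
    obtain ⟨g, hg, hgI⟩ := exists_form_forall_mul_mem hψ hψ' hJ hem
      (Finsupp.equivFunOnFinite.symm a)
      (by
        rw [Finsupp.degree_eq_sum]
        simp only [Finsupp.equivFunOnFinite_symm_apply_apply, hsum]
        omega)
      (fun i => by
        have := ha i
        simp only [Finsupp.equivFunOnFinite_symm_apply_apply]
        omega)
    exact annihilator_le_pow_idealOfVars hI2 (by omega)
      (mem_symbolicPower_of_forall_mul_mem hrad hI2 hgI) hg
  · rw [Fintype.card_fin] at ha
    by_cases h : 2 * (e + t) ≤ a
    · omega
    · obtain ⟨b, hb⟩ := exists_add_of_le (not_le.1 h).le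
      have := he2 b (by nlinarith)
      omega
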